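/- For $x\in\mathbb{R}$ let $\|x\|$ denote the distance from $x$ to the nearest integer. Let $b\geq 2$ be an integer and let $A=(a_n)_{n\geq1}$ be a strictly increasing sequence of positive integers with $\eta:=\limsup_{n\to\infty}\frac{a_{n+1}}{a_n}<+\infty$. For irrational $\xi\in\mathbb{R}$ let $$v_{b,A}(\xi):=\sup\{v\geq0:\ \|b^{a_n}\xi\|<(b^{a_n})^{-v}\text{ for infinitely many }n\}\in[0,+\infty],$$ $$\hat v_{b,A}(\xi):=\sup\Big\{v\geq0:\ \min_{1\leq n\leq N}\|b^{a_n}\xi\|<(b^{a_N})^{-v}\text{ for all sufficiently large }N\Big\}\in[0,+\infty].$$ Let $\dim_{\rm H}$ denote Hausdorff dimension, with $\dim_{\rm H}\emptyset=0$. Let $\theta$ and $\hat v$ be positive real numbers with $\hat v<\eta$. (i) If $\theta<\max\{1,\frac1{\eta-\hat v}\}$, then there is no irrational $\xi$ with $\hat v_{b,A}(\xi)\geq\hat v$ and $v_{b,A}(\xi)=\theta\hat v$. (ii) If $\theta\geq\max\{1,\frac1{\eta-\hat v}\}$, then $$\dim_{\rm H}\{\xi\in\mathbb{R}\setminus\mathbb{Q}:\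 \hat v_{b,A}(\xi)\geq\hat v\text{ and }v_{b,A}(\xi)=\theta\hat v\}\leq\frac{\eta\theta-1-\theta\hat v}{(\eta\theta-1)(1+\theta\hat v)}.$$ (iii) If $\theta\geq\max\{1,\frac1{\eta-\hat v}\}$, then for all real $\rho\geq0$, $$\dim_{\rm H}\{\xi\in\mathbb{R}\setminus\mathbb{Q}:\ \hat v_{b,A}(\xi)\geq\hat v\text{ and }\theta\hat v\leq v_{b,A}(\xi)\leq\theta\hat v+\rho\}\leq\frac{\hat v(\eta\theta-1-\theta\hat v)+\rho(\eta-\hat v)}{(1+\theta\hat v)\big((\eta\theta-1)\hat v+\eta\rho\big)}.$$ Furthermore, $\dim_{\rm H}\{\xi\in\mathbb{R}\setminus\mathbb{Q}:\ \hat v_{b,A}(\xi)\geq\eta\}=0$. -/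

import Mathlib

open Filter
open scoped ENNReal NNReal

noncomputable section

/-- The distance `‖x‖` from a real number `x` to the nearest integer. -/
def nearestIntDist (x : ℝ) : ℝ := |x - round x|

/-- The limit superior of the ratios of consecutive terms of a sequence of positive integers, with
values in `[-∞, ∞]`. -/
def limsupRatio (a : ℕ → ℕ) : EReal :=
  limsup (fun n : ℕ => (((a (n + 1) : ℝ) / (a n : ℝ) : ℝ) : EReal)) atTop

/-- The asymptotic exponent `v_{b,A}(ξ) ∈ [0, ∞]`: the supremum of the `v ≥ 0` such that
`‖b ^ {a_n} ξ‖ < (b ^ {a_n}) ^ (-v)` for infinitely many `n`.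
The sequence `A` is enumerated as `a 0 < a 1 < ⋯`. -/
def asympExponent (b : ℕ) (a : ℕ → ℕ) (ξ : ℝ) : ℝ≥0∞ :=
  sSup {w : ℝ≥0∞ | ∃ v : ℝ≥0, w = (v : ℝ≥0∞) ∧
    ∃ᶠ n in atTop, nearestIntDist ((b : ℝ) ^ a n * ξ) < ((b : ℝ) ^ a n) ^ (-(v : ℝ))}

/-- The uniform exponent `v̂_{b,A}(ξ) ∈ [0, ∞]`: the supremum of the `v ≥ 0` such that for all
sufficiently large `N` some term `a_n` with index `n ≤ N` satisfies
`‖b ^ {a_n} ξ‖ < (b ^ {a_N}) ^ (-v)`. -/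
def unifExponent (b : ℕ) (a : ℕ → ℕ) (ξ : ℝ) : ℝ≥0∞ :=
  sSup {w : ℝ≥0∞ | ∃ v : ℝ≥0, w = (v : ℝ≥0∞) ∧
    ∀ᶠ N in atTop, ∃ n ≤ N,
      nearestIntDist ((b : ℝ) ^ a n * ξ) < ((b : ℝ) ^ a N) ^ (-(v : ℝ))}

/-- The set of irrational `ξ` with `v_{b,A}(ξ) = v`. -/
def asympLevelSet (b : ℕ) (a : ℕ → ℕ) (v : ℝ≥0∞) : Set ℝ :=
  {ξ | Irrational ξ ∧ asympExponent b a ξ = v}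

/-- The set of irrational `ξ` with `v̂_{b,A}(ξ) ≥ v`. -/
def unifSuperlevelSet (b : ℕ) (a : ℕ → ℕ) (v : ℝ≥0∞) : Set ℝ :=
  {ξ | Irrational ξ ∧ v ≤ unifExponent b a ξ}

end

/-! Write `f n = ‖b ^ {a_n} ξ‖` and follow its strict record minima. Let `n < N` be consecutive
records and `V` an upper bound for the asymptotic exponent. Up to arbitrarily small losses, the
uniform exponent at index `N - 1` gives `f n ≤ b ^ (-c a_N)` with `c = v̂ / η`. Being a record at
`N` forces `b ^ (a_N - a_n) * f n ≥ 1/2`, since otherwise multiplication by `b ^ (a_N - a_n)` would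
scale `f n` exactly. Hence, up to constants, `c a_N ≤ V a_n` and `a_n ≤ (1 - c) a_N`, so `v̂ ≤ V (η
- v̂)`: this gives the emptiness in (i), and `V = ∞` when `v̂ ≥ η`.

For the dimension, the nearest integer at record `n` leaves `O(b ^ ((1 - c) a_N - a_n))` choices at
record `N`. By induction (`exists_coversRecords_card_le`) there are `O(b ^ (γ a_N))` choices for
every `γ` above `(ηV - v̂ - v̂V) / (ηV - v̂)`. If the asymptotic exponent is at least `w`,
infinitely many records put `ξ` within about `b ^ (-(1 + w) a_N)` of these fractions, so the
dimension is at most `γ / (1 + w)`. -/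

theorem nearestIntDist_nonneg (x : ℝ) : 0 ≤ nearestIntDist x := abs_nonneg _

theorem nearestIntDist_le_half (x : ℝ) : nearestIntDist x ≤ 1 / 2 := abs_sub_round x

theorem nearestIntDist_pos_of_irrational {x : ℝ} (hx : Irrational x) : 0 < nearestIntDist x :=
  abs_pos.2 (sub_ne_zero.2 (hx.ne_int _))

theorem nearestIntDist_natMul (m : ℕ) (x : ℝ) (h : m * nearestIntDist x < 1 / 2) :
    nearestIntDist (m * x) = m * nearestIntDist x := by
  have hd : |(m : ℝ) * x - ((m * round x : ℤ) : ℝ)| = m * nearestIntDist x := by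
    rw [nearestIntDist, ← Nat.abs_cast m, ← abs_mul, Nat.abs_cast]
    push_cast
    ring_nf
  have hr : round ((m : ℝ) * x) = m * round x := by
    by_contra hne
    have h1 : (1 : ℤ) ≤ |round ((m : ℝ) * x) - m * round x| :=
      Int.one_le_abs (sub_ne_zero.2 hne)
    have h2 : (1 : ℝ) ≤ |(round ((m : ℝ) * x) : ℝ) - ((m * round x : ℤ) : ℝ)| := by
      exact_mod_cast h1
    have h3 := abs_sub_round ((m : ℝ) * x)
    have h4 := abs_sub_le (round ((m : ℝ) * x) : ℝ) ((m : ℝ) * x) ((m * round x : ℤ) : ℝ)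
    rw [abs_sub_comm _ ((m : ℝ) * x)] at h4
    rw [hd] at h4
    linarith
  rw [nearestIntDist, hr, hd]

/-- The index `n` is a strict record minimum of the sequence `f`. -/
def IsRecordMin (f : ℕ → ℝ) (n : ℕ) : Prop := ∀ i < n, f n < f i

theorem exists_isRecordMin_le (f : ℕ → ℝ) (N : ℕ) :
    ∃ n ≤ N, IsRecordMin f n ∧ ∀ i ≤ N, f n ≤ f i := by
  induction N with
  | zero =>
    refine ⟨0, le_rfl, fun i hi => absurd hi (Nat.not_lt_zero _), fun i hi => ?_⟩
    rw [Nat.le_zero.1 hi]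
  | succ N ih =>
    obtain ⟨n, hn, hrec, hmin⟩ := ih
    by_cases h : f (N + 1) < f n
    · refine ⟨N + 1, le_rfl, fun i hi => h.trans_le (hmin i (by omega)), fun i hi => ?_⟩
      rcases Nat.le_succ_iff.1 hi with h1 | h1
      · exact h.le.trans (hmin i h1)
      · rw [h1]
    · refine ⟨n, by omega, hrec, fun i hi => ?_⟩
      rcases Nat.le_succ_iff.1 hi with h1 | h1
      · exact hmin i h1
      · rw [h1]; exact not_lt.1 h

/-- The minimum over `i ≤ N` is first attained at a record, and moving back to it only enlarges the
threshold `g`. So restricting to records loses no good approximations. -/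
theorem frequently_isRecordMin {f g : ℕ → ℝ} (hf : ∀ n, 0 < f n) (hg : Antitone g)
    (hg0 : Tendsto g atTop (nhds 0)) (h : ∃ᶠ N in atTop, ∃ n ≤ N, f n < g N) :
    ∃ᶠ n in atTop, IsRecordMin f n ∧ f n < g n := by
  rw [frequently_atTop]
  intro M
  -- Once `g N` is below the minimum of `f` up to `M`, the record found must lie beyond `M`.
  obtain ⟨m, -, -, hm⟩ := exists_isRecordMin_le f M
  obtain ⟨N, ⟨n, hnN, hn⟩, hNg⟩ := (h.and_eventually (hg0.eventually_lt_const (hf m))).exists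
  obtain ⟨k, hkN, hrec, hk⟩ := exists_isRecordMin_le f N
  have hkg : f k < g N := (hk n hnN).trans_lt hn
  refine ⟨k, ?_, hrec, hkg.trans_le (hg hkN)⟩
  by_contra hlt
  exact absurd (hm k (by omega)) (not_le.2 (hkg.trans hNg))

/-- The points of size at most `K` whose distances `‖b ^ {a_n} ξ‖` are bounded below with exponent
`V` and are uniformly small with exponent `c` relative to the next term of the sequence. -/
def boundedTypeSet (b : ℕ) (a : ℕ → ℕ) (c V : ℝ) (K : ℕ) : Set ℝ :=
  {ξ | |ξ| ≤ K ∧ (∀ n, (b : ℝ) ^ (-(V * a n + K)) ≤ nearestIntDist ((b : ℝ) ^ a n * ξ)) ∧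
    ∀ N, ∃ n ≤ N, nearestIntDist ((b : ℝ) ^ a n * ξ) ≤ (b : ℝ) ^ (K - c * a (N + 1))}

/-! ### Gaps between consecutive records -/

section

variable {b : ℕ} {a : ℕ → ℕ} {c V : ℝ} {K : ℕ} {ξ : ℝ}

theorem exists_previous_record (hb : 2 ≤ b) (ha : StrictMono a)
    (hξ : ξ ∈ boundedTypeSet b a c V K) {N : ℕ} (hN : 0 < N)
    (hrec : IsRecordMin (fun n => nearestIntDist ((b : ℝ) ^ a n * ξ)) N) :
    ∃ n < N, IsRecordMin (fun n => nearestIntDist ((b : ℝ) ^ a n * ξ)) n ∧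
      nearestIntDist ((b : ℝ) ^ a n * ξ) ≤ (b : ℝ) ^ (K - c * a N) ∧
      1 / 2 ≤ (b : ℝ) ^ (a N - a n) * nearestIntDist ((b : ℝ) ^ a n * ξ) := by
  obtain ⟨M, rfl⟩ : ∃ M, N = M + 1 := ⟨N - 1, by omega⟩
  obtain ⟨n, hn, hnrec, hmin⟩ :=
    exists_isRecordMin_le (fun n => nearestIntDist ((b : ℝ) ^ a n * ξ)) M
  obtain ⟨i, hi, hsmall⟩ := hξ.2.2 M
  refine ⟨n, by omega, hnrec, (hmin i hi).trans hsmall, ?_⟩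
  by_contra hlt
  rw [not_le] at hlt
  have han : a n < a (M + 1) := ha (by omega)
  have hcast : (b : ℝ) ^ (a (M + 1) - a n) = ((b ^ (a (M + 1) - a n) : ℕ) : ℝ) := by push_cast; rfl
  have hmul : (b : ℝ) ^ a (M + 1) * ξ
      = ((b ^ (a (M + 1) - a n) : ℕ) : ℝ) * ((b : ℝ) ^ a n * ξ) := by
    rw [← hcast, ← mul_assoc, ← pow_add, Nat.sub_add_cancel han.le]
  have h1 := hrec n (by omega)
  simp only at h1
  rw [hcast] at hlt
  rw [hmul, nearestIntDist_natMul _ _ hlt] at h1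
  have h2 : (1 : ℝ) ≤ ((b ^ (a (M + 1) - a n) : ℕ) : ℝ) := by
    exact_mod_cast Nat.one_le_pow _ _ (by omega)
  nlinarith [nearestIntDist_nonneg ((b : ℝ) ^ a n * ξ)]

theorem antitone_rpow_sub_mul (hb : 2 ≤ b) (ha : StrictMono a) (hc : 0 ≤ c) (k : ℝ) :
    Antitone fun n => (b : ℝ) ^ (k - c * a n) := by
  intro m n hmn
  have h1 : (1 : ℝ) ≤ b := by exact_mod_cast (by omega : 1 ≤ b)
  have h2 : (a m : ℝ) ≤ a n := by exact_mod_cast ha.monotone hmn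
  exact Real.rpow_le_rpow_of_exponent_le h1 (by nlinarith)

theorem tendsto_natCast_strictMono (ha : StrictMono a) :
    Tendsto (fun n => (a n : ℝ)) atTop atTop :=
  tendsto_natCast_atTop_atTop.comp ha.tendsto_atTop

theorem tendsto_rpow_sub_mul (hb : 2 ≤ b) (ha : StrictMono a) (hc : 0 < c) (k : ℝ) :
    Tendsto (fun n => (b : ℝ) ^ (k - c * a n)) atTop (nhds 0) := by
  have h1 : (1 : ℝ) < b := by exact_mod_cast (by omega : 1 < b)
  refine (tendsto_rpow_atBot_of_base_gt_one (b : ℝ) h1).comp ?_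
  exact tendsto_atBot_add_const_left _ k
    (tendsto_neg_atTop_atBot.comp ((tendsto_natCast_strictMono ha).const_mul_atTop hc))

theorem nearestIntDist_pos_of_mem (hb : 2 ≤ b) (hξ : ξ ∈ boundedTypeSet b a c V K) (n : ℕ) :
    0 < nearestIntDist ((b : ℝ) ^ a n * ξ) := by
  have : (0 : ℝ) < b := by exact_mod_cast (by omega : 0 < b)
  exact (Real.rpow_pos_of_pos this _).trans_le (hξ.2.1 n)

theorem previous_record_exponents (hb : 2 ≤ b) (ha : StrictMono a)
    (hξ : ξ ∈ boundedTypeSet b a c V K) {n N : ℕ} (hnN : n < N)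
    (h1 : nearestIntDist ((b : ℝ) ^ a n * ξ) ≤ (b : ℝ) ^ (K - c * a N))
    (h2 : 1 / 2 ≤ (b : ℝ) ^ (a N - a n) * nearestIntDist ((b : ℝ) ^ a n * ξ)) :
    c * a N - 2 * K ≤ V * a n ∧
      (b : ℝ) ^ (a N - a n) * nearestIntDist ((b : ℝ) ^ a n * ξ) ≤
        (b : ℝ) ^ ((1 - c) * a N - a n + K) ∧
      (a n : ℝ) ≤ (1 - c) * a N + K + 1 := by
  have hb1 : (1 : ℝ) < b := by exact_mod_cast (by omega : 1 < b)
  have hb2 : (2 : ℝ) ≤ b := by exact_mod_cast hb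
  have hb0 : (0 : ℝ) < b := by linarith
  have hle : a n ≤ a N := (ha hnN).le
  have hX : (b : ℝ) ^ (a N - a n) * nearestIntDist ((b : ℝ) ^ a n * ξ) ≤
      (b : ℝ) ^ ((1 - c) * a N - a n + K) := by
    calc _ ≤ (b : ℝ) ^ (a N - a n) * (b : ℝ) ^ (K - c * a N) := by gcongr
      _ = _ := by
        rw [← Real.rpow_natCast, ← Real.rpow_add hb0]
        push_cast [Nat.cast_sub hle]
        ring_nf
  refine ⟨?_, hX, ?_⟩
  · have := (Real.rpow_le_rpow_left_iff hb1).1 ((hξ.2.1 n).trans h1)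
    linarith
  -- Replacing `1 / 2` by a power of `b` costs the extra `1` in the bound.
  · have h3 : (b : ℝ) ^ (-1 : ℝ) ≤ 1 / 2 := by
      rw [Real.rpow_neg_one, one_div]
      exact inv_anti₀ two_pos hb2
    have := (Real.rpow_le_rpow_left_iff hb1).1 (h3.trans (h2.trans hX))
    linarith

theorem frequently_isRecordMin_of_mem (hb : 2 ≤ b) (ha : StrictMono a) (hc : 0 < c)
    (hξ : ξ ∈ boundedTypeSet b a c V K) :
    ∃ᶠ n in atTop, IsRecordMin (fun n => nearestIntDist ((b : ℝ) ^ a n * ξ)) n := by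
  have hb1 : (1 : ℝ) < b := by exact_mod_cast (by omega : 1 < b)
  refine (frequently_isRecordMin (nearestIntDist_pos_of_mem hb hξ)
    (antitone_rpow_sub_mul hb ha hc.le K) (tendsto_rpow_sub_mul hb ha hc K) ?_).mono
    fun n hn => hn.1
  refine Frequently.of_forall fun N => ?_
  obtain ⟨n, hn, h⟩ := hξ.2.2 N
  refine ⟨n, hn, h.trans_lt (Real.rpow_lt_rpow_of_exponent_lt hb1 ?_)⟩
  have : (a N : ℝ) < a (N + 1) := by exact_mod_cast ha N.lt_succ_self
  nlinarith

/-- Eliminating `a n` between the two gap inequalities gives `(c - V (1 - c)) a_N ≤ O(1)`, while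
records `N` are unbounded. -/
theorem exponent_le_of_mem (hb : 2 ≤ b) (ha : StrictMono a) (hc : 0 < c) (hV : 0 ≤ V)
    (hξ : ξ ∈ boundedTypeSet b a c V K) : c ≤ V * (1 - c) := by
  by_contra hlt
  rw [not_le] at hlt
  have hδ : 0 < c - V * (1 - c) := by linarith
  have hlarge := ((tendsto_natCast_strictMono ha).const_mul_atTop hδ).eventually_gt_atTop
    (V * (K + 1) + 2 * K)
  obtain ⟨N, hrec, hN, hN0⟩ := ((frequently_isRecordMin_of_mem hb ha hc hξ).and_eventually
    (hlarge.and (eventually_gt_atTop 0))).exists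
  obtain ⟨n, hn, -, h1, h2⟩ := exists_previous_record hb ha hξ hN0 hrec
  obtain ⟨h3, -, h4⟩ := previous_record_exponents hb ha hξ hn h1 h2
  nlinarith

end
-- Counting nearest integers at records
/-- The finite set `F` contains the nearest integer to `b ^ {a_N} ξ` for each `ξ` in the bounded
type set for which `N` is a record. -/
def CoversRecords (b : ℕ) (a : ℕ → ℕ) (c V : ℝ) (K N : ℕ) (F : Finset ℤ) : Prop :=
  ∀ ξ ∈ boundedTypeSet b a c V K,
    IsRecordMin (fun n => nearestIntDist ((b : ℝ) ^ a n * ξ)) N → round ((b : ℝ) ^ a N * ξ) ∈ F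

/-- The integers of absolute value at most `K * m + 1`. -/
noncomputable def boundedIntegers (K m : ℕ) : Finset ℤ := Finset.Icc (-(K * m + 1)) (K * m + 1)

theorem round_mem_boundedIntegers {K m : ℕ} {ξ : ℝ} (hξ : |ξ| ≤ K) :
    round ((m : ℝ) * ξ) ∈ boundedIntegers K m := by
  have h1 := abs_sub_round ((m : ℝ) * ξ)
  have h2 : |(m : ℝ) * ξ| ≤ m * K := by
    rw [abs_mul, Nat.abs_cast]; gcongr
  rw [abs_le] at h1 h2
  have h3 : (round ((m : ℝ) * ξ) : ℝ) ≤ ((K * m + 1 : ℤ) : ℝ) := by push_cast; nlinarith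
  have h4 : ((-(K * m + 1) : ℤ) : ℝ) ≤ (round ((m : ℝ) * ξ) : ℝ) := by push_cast; nlinarith
  exact Finset.mem_Icc.2 ⟨by exact_mod_cast h4, by exact_mod_cast h3⟩

theorem card_boundedIntegers (K m : ℕ) : (boundedIntegers K m).card = 2 * (K * m) + 3 := by
  rw [boundedIntegers, Int.card_Icc]
  omega

/-- The integers within the rounded radius `X + 1 / 2` of `m`. -/
noncomputable def integersNear (X : ℝ) (m : ℤ) : Finset ℤ :=
  Finset.Icc (m - ⌊X + 1 / 2⌋) (m + ⌊X + 1 / 2⌋)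

theorem card_integersNear {X : ℝ} (hX : 1 / 2 ≤ X) (m : ℤ) :
    ((integersNear X m).card : ℝ) ≤ 6 * X := by
  have h0 : (0 : ℤ) ≤ ⌊X + 1 / 2⌋ := Int.floor_nonneg.2 (by linarith)
  have h1 : ((integersNear X m).card : ℤ) = 2 * ⌊X + 1 / 2⌋ + 1 := by
    rw [integersNear, Int.card_Icc]; omega
  have h2 : ((integersNear X m).card : ℝ) = 2 * (⌊X + 1 / 2⌋ : ℝ) + 1 := by exact_mod_cast h1
  rw [h2]
  linarith [Int.floor_le (X + 1 / 2)]

theorem round_mul_mem_integersNear {X : ℝ} {m : ℕ} {x : ℝ} (h : m * nearestIntDist x ≤ X) :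
    round ((m : ℝ) * x) ∈ integersNear X (m * round x) := by
  have h1 := abs_sub_round ((m : ℝ) * x)
  have hd : |(m : ℝ) * x - m * round x| ≤ X := by
    rwa [← mul_sub, abs_mul, Nat.abs_cast]
  rw [abs_le] at h1 hd
  have h2 : round ((m : ℝ) * x) - m * round x ≤ ⌊X + 1 / 2⌋ :=
    Int.le_floor.2 (by push_cast; linarith)
  have h3 : m * round x - round ((m : ℝ) * x) ≤ ⌊X + 1 / 2⌋ :=
    Int.le_floor.2 (by push_cast; linarith)
  exact Finset.mem_Icc.2 ⟨by linarith, by linarith⟩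

section

variable {b : ℕ} {a : ℕ → ℕ} {c V : ℝ} {K : ℕ}

theorem exists_coversRecords_of_previous (hb : 2 ≤ b) (ha : StrictMono a) {N : ℕ} (hN : 0 < N)
    (G : ℕ → Finset ℤ) (hG : ∀ n < N, CoversRecords b a c V K n (G n)) {D : ℝ} (hD : 0 ≤ D)
    (hcard : ∀ n < N, c * a N - 2 * K ≤ V * a n →
      ((G n).card : ℝ) * (6 * (b : ℝ) ^ ((1 - c) * a N - a n + K)) ≤ D) :
    ∃ F, CoversRecords b a c V K N F ∧ (F.card : ℝ) ≤ N * D := by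
  classical
  let X : ℕ → ℝ := fun n => (b : ℝ) ^ ((1 - c) * a N - a n + K)
  -- The condition `1 / 2 ≤ X n` holds at the previous record and absorbs the rounding errors into
  -- `6 * X n`.
  let S := (Finset.range N).filter fun n => c * a N - 2 * K ≤ V * a n ∧ 1 / 2 ≤ X n
  refine ⟨S.biUnion fun n => (G n).biUnion fun p =>
    integersNear (X n) ((b ^ (a N - a n) : ℕ) * p), ?_, ?_⟩
  · intro ξ hξ hrec
    obtain ⟨n, hn, hnrec, h1, h2⟩ := exists_previous_record hb ha hξ hN hrec
    obtain ⟨h3, h4, -⟩ := previous_record_exponents hb ha hξ hn h1 h2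
    refine Finset.mem_biUnion.2 ⟨n, ?_, Finset.mem_biUnion.2 ⟨_, hG n hn ξ hξ hnrec, ?_⟩⟩
    · exact Finset.mem_filter.2 ⟨Finset.mem_range.2 hn, h3, h2.trans h4⟩
    · have hmul : (b : ℝ) ^ a N * ξ = ((b ^ (a N - a n) : ℕ) : ℝ) * ((b : ℝ) ^ a n * ξ) := by
        rw [Nat.cast_pow, ← mul_assoc, ← pow_add, Nat.sub_add_cancel (ha hn).le]
      rw [hmul]
      refine round_mul_mem_integersNear ?_
      rw [Nat.cast_pow]
      exact h4
  · have hS : (S.card : ℝ) ≤ N := by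
      exact_mod_cast (Finset.card_filter_le _ _).trans (Finset.card_range N).le
    refine le_trans ?_ (mul_le_mul_of_nonneg_right hS hD)
    refine (Nat.cast_le.2 Finset.card_biUnion_le).trans ?_
    push_cast
    rw [← nsmul_eq_mul]
    refine Finset.sum_le_card_nsmul _ _ _ fun n hn => ?_
    obtain ⟨hnN, h1, h2⟩ := Finset.mem_filter.1 hn
    refine le_trans ?_ (hcard n (Finset.mem_range.1 hnN) h1)
    refine (Nat.cast_le.2 Finset.card_biUnion_le).trans ?_
    push_cast
    rw [← nsmul_eq_mul]
    exact Finset.sum_le_card_nsmul _ _ _ fun p _ => card_integersNear h2 _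

theorem eventually_mul_le_rpow (hb : 2 ≤ b) (ha : StrictMono a) {δ : ℝ} (hδ : 0 < δ) (M : ℝ) :
    ∀ᶠ N : ℕ in atTop, (N : ℝ) * M ≤ (b : ℝ) ^ (δ * a N) := by
  have hb1 : (1 : ℝ) < b := by exact_mod_cast (by omega : 1 < b)
  have hlog : 0 < Real.log b := Real.log_pos hb1
  have h := (isLittleO_pow_exp_pos_mul_atTop 1 (mul_pos hlog hδ)).bound
    (show (0 : ℝ) < 1 / (|M| + 1) by positivity)
  filter_upwards [(tendsto_natCast_strictMono ha).eventually h] with N hN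
  have haN : (N : ℝ) ≤ a N := by exact_mod_cast ha.le_apply
  rw [pow_one, Real.norm_eq_abs, Real.norm_eq_abs, Real.abs_exp, Nat.abs_cast,
    one_div, inv_mul_eq_div, le_div_iff₀ (by positivity)] at hN
  rw [Real.rpow_def_of_pos (by linarith), ← mul_assoc]
  refine le_trans ?_ hN
  have := le_abs_self M
  have h0 : (0 : ℝ) ≤ N := N.cast_nonneg
  have h1 := abs_nonneg M
  calc (N : ℝ) * M ≤ N * (|M| + 1) := by gcongr; linarith
    _ ≤ _ := by gcongr

/-- The condition on `γ` says that one induction step gains a factor `b ^ (-δ a_N)`, which pays for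
the bounded factors and for the at most `N` candidates for the previous record. The same `C` thus
survives every step. -/
theorem exists_coversRecords_card_le (hb : 2 ≤ b) (ha : StrictMono a) (hV : 0 < V) {γ : ℝ}
    (hγ0 : 0 ≤ γ) (hγ1 : γ ≤ 1) (hγ : (1 - γ) * (1 - c / V) < c) :
    ∃ C : ℝ, ∀ N, ∃ F, CoversRecords b a c V K N F ∧ (F.card : ℝ) ≤ C * (b : ℝ) ^ (γ * a N) := by
  have hb1 : (1 : ℝ) < b := by exact_mod_cast (by omega : 1 < b)
  have hb0 : (0 : ℝ) < b := by linarith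
  set δ := c - (1 - γ) * (1 - c / V) with hδ
  have hδ0 : 0 < δ := by linarith
  set L : ℝ := K + (1 - γ) * (2 * K / V) with hL
  obtain ⟨N₀, hN₀⟩ := eventually_atTop.1
    (eventually_mul_le_rpow hb ha hδ0 (6 * (b : ℝ) ^ L))
  set C : ℝ := ∑ n ∈ Finset.range (N₀ + 1), ((boundedIntegers K (b ^ a n)).card : ℝ) with hC
  have hC0 : 0 ≤ C := Finset.sum_nonneg fun _ _ => Nat.cast_nonneg _
  have hCcard : ∀ n < N₀ + 1, ((boundedIntegers K (b ^ a n)).card : ℝ) ≤ C := fun n hn =>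
    Finset.single_le_sum (f := fun n => ((boundedIntegers K (b ^ a n)).card : ℝ))
      (fun _ _ => Nat.cast_nonneg _) (Finset.mem_range.2 hn)
  clear_value C δ L
  refine ⟨C, fun N => ?_⟩
  induction N using Nat.strong_induction_on with
  | _ N ih =>
    rcases Nat.lt_or_ge N (N₀ + 1) with hlt | hge
    · refine ⟨boundedIntegers K (b ^ a N), fun ξ hξ _ => ?_, ?_⟩
      · have := round_mem_boundedIntegers (m := b ^ a N) hξ.1
        rwa [Nat.cast_pow] at this
      · exact (hCcard N hlt).trans (le_mul_of_one_le_right hC0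
          (Real.one_le_rpow hb1.le (by positivity)))
    · have hex : ∀ n, ∃ F, n < N →
          CoversRecords b a c V K n F ∧ (F.card : ℝ) ≤ C * (b : ℝ) ^ (γ * a n) := by
        intro n
        by_cases hn : n < N
        · obtain ⟨F, hF⟩ := ih n hn
          exact ⟨F, fun _ => hF⟩
        · exact ⟨∅, fun h => absurd h hn⟩
      choose G hG using hex
      have hstep : ∀ n < N, c * a N - 2 * K ≤ V * a n →
          ((G n).card : ℝ) * (6 * (b : ℝ) ^ ((1 - c) * a N - a n + K)) ≤
            C * (6 * (b : ℝ) ^ L * (b : ℝ) ^ ((γ - δ) * a N)) := by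
        intro n hn hcond
        -- As `γ ≤ 1`, the exponent is nonincreasing in `a n`, so the worst case is the smallest
        -- permitted gap endpoint `(c * a N - 2 * K) / V`.
        have hexp : γ * a n + ((1 - c) * a N - a n + K) ≤ L + (γ - δ) * a N := by
          have h1 : (c * a N - 2 * K) / V ≤ a n := by
            rw [div_le_iff₀ hV]; linarith
          have h2 := mul_le_mul_of_nonneg_left h1 (sub_nonneg.2 hγ1)
          have h3 : L + (γ - δ) * a N = (1 - c) * a N + K - (1 - γ) * ((c * a N - 2 * K) / V) := by
            rw [hL, hδ]; ring
          linarith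
        calc ((G n).card : ℝ) * (6 * (b : ℝ) ^ ((1 - c) * a N - a n + K))
            ≤ (C * (b : ℝ) ^ (γ * a n)) * (6 * (b : ℝ) ^ ((1 - c) * a N - a n + K)) := by
              gcongr
              exact (hG n hn).2
          _ = C * (6 * (b : ℝ) ^ (γ * a n + ((1 - c) * a N - a n + K))) := by
              rw [Real.rpow_add hb0 (γ * a n)]; ring
          _ ≤ C * (6 * (b : ℝ) ^ (L + (γ - δ) * a N)) := by
              gcongr
              exact hb1.le
          _ = _ := by rw [Real.rpow_add hb0]; ring
      obtain ⟨F, hF, hcard⟩ := exists_coversRecords_of_previous hb ha (by omega : 0 < N) G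
        (fun n hn => (hG n hn).1) (by positivity) hstep
      refine ⟨F, hF, hcard.trans ?_⟩
      calc (N : ℝ) * (C * (6 * (b : ℝ) ^ L * (b : ℝ) ^ ((γ - δ) * a N)))
          = C * ((N * (6 * (b : ℝ) ^ L)) * (b : ℝ) ^ ((γ - δ) * a N)) := by ring
        _ ≤ C * ((b : ℝ) ^ (δ * a N) * (b : ℝ) ^ ((γ - δ) * a N)) := by
            gcongr
            exact hN₀ N (by omega)
        _ = C * (b : ℝ) ^ (γ * a N) := by
            rw [← Real.rpow_add hb0]; ring_nf

/-! ### Hausdorff dimension from covers by rational balls -/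

open MeasureTheory Metric in
theorem dimH_le_of_frequently_near (hb : 2 ≤ b) (ha : StrictMono a) {γ w C : ℝ} {s : ℝ≥0}
    (hγ : 0 ≤ γ) (hw : 0 ≤ w) (hs : γ < s * (1 + w)) (F : ℕ → Finset ℤ)
    (hF : ∀ N, ((F N).card : ℝ) ≤ C * (b : ℝ) ^ (γ * a N)) {E : Set ℝ}
    (hE : ∀ ξ ∈ E, ∃ᶠ N in atTop, round ((b : ℝ) ^ a N * ξ) ∈ F N ∧
      nearestIntDist ((b : ℝ) ^ a N * ξ) ≤ (b : ℝ) ^ (-(w * a N))) :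
    dimH E ≤ s := by
  have hb1 : (1 : ℝ) < b := by exact_mod_cast (by omega : 1 < b)
  have hb0 : (0 : ℝ) < b := by linarith
  have hs0 : (0 : ℝ) < s := by
    by_contra h
    have : (s : ℝ) = 0 := le_antisymm (not_lt.1 h) s.coe_nonneg
    rw [this] at hs
    linarith
  have hC : 0 ≤ C := by
    have h1 := (Nat.cast_nonneg _).trans (hF 0)
    exact nonneg_of_mul_nonneg_left h1 (by positivity)
  set R : ℕ → ℝ := fun N => (b : ℝ) ^ (-((1 + w) * a N)) with hR
  have hR0 : ∀ N, 0 ≤ R N := fun N => by positivity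
  -- Making the balls of index below `M` empty keeps one index type for all the covers.
  set T : ∀ M : ℕ, (Σ N, F N) → Set ℝ := fun M i =>
    if M ≤ i.1 then closedBall (((i.2 : ℤ) : ℝ) / (b : ℝ) ^ a i.1) (R i.1) else ∅ with hT
  have hdiam : ∀ M i, ediam (T M i) ≤ ENNReal.ofReal (2 * R i.1) := by
    intro M i
    by_cases h : M ≤ i.1
    · simp only [hT, h, if_true]
      rw [Real.closedBall_eq_Icc, Real.ediam_Icc]
      exact ENNReal.ofReal_le_ofReal (by linarith)
    · simp [hT, h]
  have hRanti : Antitone R := by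
    have := antitone_rpow_sub_mul hb ha (c := 1 + w) (by linarith) 0
    simpa only [zero_sub] using this
  have hRlim : Tendsto R atTop (nhds 0) := by
    have := tendsto_rpow_sub_mul hb ha (c := 1 + w) (by linarith) 0
    simpa only [zero_sub] using this
  have hsum : ∀ M, ∑' i, ediam (T M i) ^ (s : ℝ) ≤
      ∑' N, ENNReal.ofReal (C * 2 ^ (s : ℝ) * (b : ℝ) ^ (-((s * (1 + w) - γ) * a N))) := by
    intro M
    refine (ENNReal.tsum_le_tsum fun i => ENNReal.rpow_le_rpow (hdiam M i) s.coe_nonneg).trans ?_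
    rw [ENNReal.tsum_sigma']
    refine ENNReal.tsum_le_tsum fun N => ?_
    change ∑' _ : F N, ENNReal.ofReal (2 * R N) ^ (s : ℝ) ≤ _
    rw [tsum_fintype, Finset.sum_const, Finset.card_univ, Fintype.card_coe, nsmul_eq_mul,
      ENNReal.ofReal_rpow_of_nonneg (by have := hR0 N; positivity) s.coe_nonneg,
      ← ENNReal.ofReal_natCast, ← ENNReal.ofReal_mul (Nat.cast_nonneg _)]
    refine ENNReal.ofReal_le_ofReal ?_
    calc ((F N).card : ℝ) * (2 * R N) ^ (s : ℝ)
        ≤ (C * (b : ℝ) ^ (γ * a N)) * (2 * R N) ^ (s : ℝ) := by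
          gcongr
          exact hF N
      _ = C * 2 ^ (s : ℝ) * ((b : ℝ) ^ (γ * a N) * (R N) ^ (s : ℝ)) := by
          rw [Real.mul_rpow two_pos.le (hR0 N)]; ring
      _ = _ := by
          rw [hR, ← Real.rpow_mul hb0.le, ← Real.rpow_add hb0]
          ring_nf
  have hfin : ∑' N, ENNReal.ofReal (C * 2 ^ (s : ℝ) *
      (b : ℝ) ^ (-((s * (1 + w) - γ) * a N))) ≠ ∞ := by
    have hδ : 0 < s * (1 + w) - γ := by linarith
    refine Summable.tsum_ofReal_ne_top (Summable.mul_left _ ?_)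
    have hq : (b : ℝ) ^ (-(s * (1 + w) - γ)) < 1 :=
      Real.rpow_lt_one_of_one_lt_of_neg hb1 (by linarith)
    refine Summable.of_nonneg_of_le (fun N => by positivity) (fun N => ?_)
      (summable_geometric_of_lt_one (by positivity) hq)
    rw [← Real.rpow_natCast, ← Real.rpow_mul hb0.le]
    have haN : (N : ℝ) ≤ a N := by exact_mod_cast ha.le_apply
    exact Real.rpow_le_rpow_of_exponent_le hb1.le (by nlinarith)
  refine dimH_le_of_hausdorffMeasure_ne_top (ne_top_of_le_ne_top hfin ?_)
  refine (Measure.hausdorffMeasure_le_liminf_tsum (s : ℝ) E (l := atTop)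
    (fun M => ENNReal.ofReal (2 * R M)) ?_ T ?_ ?_).trans ?_
  · have := ENNReal.tendsto_ofReal (hRlim.const_mul 2)
    simpa using this
  · refine Eventually.of_forall fun M i => ?_
    by_cases h : M ≤ i.1
    · exact (hdiam M i).trans (ENNReal.ofReal_le_ofReal (by have := hRanti h; linarith))
    · simp [hT, h]
  · refine Eventually.of_forall fun M ξ hξ => ?_
    obtain ⟨N, ⟨hNF, hNd⟩, hMN⟩ := ((hE ξ hξ).and_eventually (eventually_ge_atTop M)).exists
    refine Set.mem_iUnion.2 ⟨⟨N, ⟨_, hNF⟩⟩, ?_⟩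
    simp only [hT, hMN, if_true, mem_closedBall, Real.dist_eq]
    have hp : (0 : ℝ) < (b : ℝ) ^ a N := by positivity
    have hx : ξ - (round ((b : ℝ) ^ a N * ξ) : ℝ) / (b : ℝ) ^ a N =
        ((b : ℝ) ^ a N * ξ - round ((b : ℝ) ^ a N * ξ)) / (b : ℝ) ^ a N := by
      field_simp
    rw [hx, abs_div, abs_of_pos hp, div_le_iff₀ hp]
    refine hNd.trans (le_of_eq ?_)
    rw [hR, ← Real.rpow_natCast, ← Real.rpow_add hb0]
    ring_nf
  · exact (liminf_le_liminf (Eventually.of_forall hsum)).trans (by simp)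

end
-- From exponents to bounded type sets
theorem exists_nat_forall_of_eventually {P : ℕ → ℕ → Prop}
    (hmono : ∀ n K K', K ≤ K' → P n K → P n K') (h0 : ∀ᶠ n in atTop, P n 0)
    (h : ∀ n, ∃ K, P n K) : ∃ K, ∀ n, P n K := by
  choose k hk using h
  obtain ⟨N, hN⟩ := eventually_atTop.1 h0
  refine ⟨(Finset.range N).sup k, fun n => ?_⟩
  rcases Nat.lt_or_ge n N with hn | hn
  · exact hmono n _ _ (Finset.le_sup (Finset.mem_range.2 hn)) (hk n)
  · exact hmono n _ _ (Nat.zero_le _) (hN n hn)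

theorem coe_lt_of_ofReal_lt_coe {x : ℝ} {v : ℝ≥0} (h : ENNReal.ofReal x < v) : x < v :=
  (Real.le_coe_toNNReal x).trans_lt (NNReal.coe_lt_coe.2 (ENNReal.coe_lt_coe.1 h))

section

variable {b : ℕ} {a : ℕ → ℕ} {ξ : ℝ}

theorem pow_rpow_neg (b k : ℕ) (v : ℝ) : ((b : ℝ) ^ k) ^ (-v) = (b : ℝ) ^ (-(v * k)) := by
  rw [← Real.rpow_natCast, ← Real.rpow_mul b.cast_nonneg]
  ring_nf

theorem nearestIntDist_pow_mul_pos (hb : 2 ≤ b) (hξ : Irrational ξ) (k : ℕ) :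
    0 < nearestIntDist ((b : ℝ) ^ k * ξ) := by
  have := hξ.natCast_mul (m := b ^ k) (pow_ne_zero _ (by omega))
  rw [Nat.cast_pow] at this
  exact nearestIntDist_pos_of_irrational this

theorem rpow_neg_mul_le (hb : 2 ≤ b) {v w : ℝ} (h : w ≤ v) (k : ℕ) :
    (b : ℝ) ^ (-(v * k)) ≤ (b : ℝ) ^ (-(w * k)) := by
  have h1 : (1 : ℝ) ≤ b := by exact_mod_cast (by omega : 1 ≤ b)
  have h2 : (0 : ℝ) ≤ k := k.cast_nonneg
  exact Real.rpow_le_rpow_of_exponent_le h1 (by nlinarith)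

theorem frequently_lt_of_lt_asympExponent (hb : 2 ≤ b) {w : ℝ}
    (h : ENNReal.ofReal w < asympExponent b a ξ) :
    ∃ᶠ n in atTop, nearestIntDist ((b : ℝ) ^ a n * ξ) < (b : ℝ) ^ (-(w * a n)) := by
  obtain ⟨_, ⟨v, rfl, hv⟩, hwv⟩ := lt_sSup_iff.1 h
  refine hv.mono fun n hn => hn.trans_le ?_
  rw [pow_rpow_neg]
  exact rpow_neg_mul_le hb (coe_lt_of_ofReal_lt_coe hwv).le _

theorem eventually_le_of_asympExponent_lt {V : ℝ} (hV : 0 ≤ V)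
    (h : asympExponent b a ξ < ENNReal.ofReal V) :
    ∀ᶠ n in atTop, (b : ℝ) ^ (-(V * a n)) ≤ nearestIntDist ((b : ℝ) ^ a n * ξ) := by
  by_contra hne
  rw [not_eventually] at hne
  refine h.not_ge (le_sSup ⟨V.toNNReal, rfl, hne.mono fun n hn => ?_⟩)
  rw [pow_rpow_neg, Real.coe_toNNReal _ hV]
  exact not_le.1 hn

theorem eventually_exists_lt_of_lt_unifExponent (hb : 2 ≤ b) {w : ℝ}
    (h : ENNReal.ofReal w < unifExponent b a ξ) :
    ∀ᶠ N in atTop, ∃ n ≤ N, nearestIntDist ((b : ℝ) ^ a n * ξ) < (b : ℝ) ^ (-(w * a N)) := by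
  obtain ⟨_, ⟨v, rfl, hv⟩, hwv⟩ := lt_sSup_iff.1 h
  refine hv.mono fun N hN => ?_
  obtain ⟨n, hn, hlt⟩ := hN
  refine ⟨n, hn, hlt.trans_le ?_⟩
  rw [pow_rpow_neg]
  exact rpow_neg_mul_le hb (coe_lt_of_ofReal_lt_coe hwv).le _

theorem eventually_succ_le_of_limsupRatio_lt (ha_pos : ∀ n, 0 < a n) {η η' : ℝ}
    (hη : limsupRatio a = (η : EReal)) (h : η < η') :
    ∀ᶠ n in atTop, (a (n + 1) : ℝ) ≤ η' * a n := by
  have h1 : limsupRatio a < (η' : EReal) := by rw [hη]; exact_mod_cast h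
  filter_upwards [eventually_lt_of_limsup_lt h1] with n hn
  have h2 : (0 : ℝ) < a n := by exact_mod_cast ha_pos n
  exact ((div_lt_iff₀ h2).1 (EReal.coe_lt_coe_iff.1 hn)).le

theorem one_le_of_limsupRatio_eq (ha_pos : ∀ n, 0 < a n) (ha : StrictMono a) {η : ℝ}
    (hη : limsupRatio a = (η : EReal)) : 1 ≤ η := by
  by_contra hlt
  obtain ⟨n, hn⟩ := (eventually_succ_le_of_limsupRatio_lt ha_pos hη (not_le.1 hlt)).exists
  have : (a n : ℝ) < a (n + 1) := by exact_mod_cast ha n.lt_succ_self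
  linarith

theorem frequently_isRecordMin_and_lt (hb : 2 ≤ b) (ha : StrictMono a) (hξ : Irrational ξ)
    {w : ℝ} (hw : 0 < w)
    (h : ∃ᶠ N in atTop, ∃ n ≤ N,
      nearestIntDist ((b : ℝ) ^ a n * ξ) < (b : ℝ) ^ (-(w * a N))) :
    ∃ᶠ n in atTop, IsRecordMin (fun n => nearestIntDist ((b : ℝ) ^ a n * ξ)) n ∧
      nearestIntDist ((b : ℝ) ^ a n * ξ) < (b : ℝ) ^ (-(w * a n)) := by
  have h1 := antitone_rpow_sub_mul hb ha hw.le 0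
  have h2 := tendsto_rpow_sub_mul hb ha hw 0
  simp only [zero_sub] at h1 h2
  exact frequently_isRecordMin (fun n => nearestIntDist_pow_mul_pos hb hξ (a n)) h1 h2 h

theorem unifExponent_le_asympExponent (hb : 2 ≤ b) (ha : StrictMono a) (hξ : Irrational ξ) :
    unifExponent b a ξ ≤ asympExponent b a ξ := by
  refine sSup_le ?_
  rintro _ ⟨v, rfl, hv⟩
  rcases eq_or_ne v 0 with rfl | hv0
  · simp
  refine le_sSup ⟨v, rfl, ?_⟩
  simp only [pow_rpow_neg] at hv ⊢
  exact (frequently_isRecordMin_and_lt hb ha hξ (NNReal.coe_pos.2 (pos_iff_ne_zero.2 hv0))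
    hv.frequently).mono fun n hn => hn.2

theorem exists_mem_boundedTypeSet (hb : 2 ≤ b) (ha_pos : ∀ n, 0 < a n)
    {η η' v V : ℝ} (hη : limsupRatio a = (η : EReal)) (hη' : η < η') (hη0 : 0 < η') (hv : 0 ≤ v)
    (hV : 0 ≤ V) (hξ : Irrational ξ) (hu : ENNReal.ofReal v < unifExponent b a ξ)
    (has : asympExponent b a ξ < ENNReal.ofReal V) :
    ∃ K, ξ ∈ boundedTypeSet b a (v / η') V K := by
  have hb1 : (1 : ℝ) < b := by exact_mod_cast (by omega : 1 < b)
  obtain ⟨K₁, hK₁⟩ := exists_nat_forall_of_eventually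
    (P := fun n K => (b : ℝ) ^ (-(V * a n + K)) ≤ nearestIntDist ((b : ℝ) ^ a n * ξ))
    (fun n K K' hKK h => (Real.rpow_le_rpow_of_exponent_le hb1.le (by
      have : (K : ℝ) ≤ K' := by exact_mod_cast hKK
      linarith)).trans h)
    (by simpa using eventually_le_of_asympExponent_lt hV has)
    (fun n => by
      have hpos := nearestIntDist_pow_mul_pos hb hξ (a n)
      obtain ⟨K, hK⟩ := exists_nat_ge
        (-(Real.logb b (nearestIntDist ((b : ℝ) ^ a n * ξ))) - V * a n)
      exact ⟨K, (Real.le_logb_iff_rpow_le hb1 hpos).1 (by linarith)⟩)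
  obtain ⟨K₂, hK₂⟩ := exists_nat_forall_of_eventually
    (P := fun N K => ∃ n ≤ N,
      nearestIntDist ((b : ℝ) ^ a n * ξ) ≤ (b : ℝ) ^ (K - v / η' * a (N + 1)))
    (fun N K K' hKK ⟨n, hn, h⟩ => ⟨n, hn, h.trans (Real.rpow_le_rpow_of_exponent_le hb1.le (by
      have : (K : ℝ) ≤ K' := by exact_mod_cast hKK
      linarith))⟩)
    (by
      filter_upwards [eventually_exists_lt_of_lt_unifExponent hb hu,
        eventually_succ_le_of_limsupRatio_lt ha_pos hη hη'] with N ⟨n, hn, h⟩ hN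
      refine ⟨n, hn, h.le.trans (Real.rpow_le_rpow_of_exponent_le hb1.le ?_)⟩
      have h1 : v / η' * a (N + 1) ≤ v * a N := by
        calc v / η' * a (N + 1) ≤ v / η' * (η' * a N) := by gcongr
          _ = v * a N := by field_simp
      rw [Nat.cast_zero]
      linarith)
    -- For one fixed `N`, a large `K` makes the right side at least `1`, so `n = 0` works.
    (fun N => by
      obtain ⟨K, hK⟩ := exists_nat_ge (v / η' * a (N + 1))
      refine ⟨K, 0, N.zero_le, ?_⟩
      have := nearestIntDist_le_half ((b : ℝ) ^ a 0 * ξ)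
      have := Real.one_le_rpow hb1.le (sub_nonneg.2 hK)
      linarith)
  obtain ⟨K₃, hK₃⟩ := exists_nat_ge |ξ|
  have h1 : (K₁ : ℝ) ≤ (K₁ + K₂ + K₃ : ℕ) := by exact_mod_cast (by omega)
  have h2 : (K₂ : ℝ) ≤ (K₁ + K₂ + K₃ : ℕ) := by exact_mod_cast (by omega)
  have h3 : (K₃ : ℝ) ≤ (K₁ + K₂ + K₃ : ℕ) := by exact_mod_cast (by omega)
  refine ⟨K₁ + K₂ + K₃, hK₃.trans h3, fun n => ?_, fun N => ?_⟩
  · exact (Real.rpow_le_rpow_of_exponent_le hb1.le (by linarith)).trans (hK₁ n)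
  · obtain ⟨n, hn, h⟩ := hK₂ N
    exact ⟨n, hn, h.trans (Real.rpow_le_rpow_of_exponent_le hb1.le (by linarith))⟩

theorem ofReal_sub_lt_of_le {x ε : ℝ} {y : ℝ≥0∞} (hx : 0 < x) (hε : 0 < ε)
    (h : ENNReal.ofReal x ≤ y) : ENNReal.ofReal (x - ε) < y :=
  ((ENNReal.ofReal_lt_ofReal_iff hx).2 (by linarith)).trans_le h

theorem lt_ofReal_add_of_le {x ε : ℝ} {y : ℝ≥0∞} (hx : 0 ≤ x) (hε : 0 < ε)
    (h : y ≤ ENNReal.ofReal x) : y < ENNReal.ofReal (x + ε) :=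
  h.trans_lt ((ENNReal.ofReal_lt_ofReal_iff (by linarith)).2 (by linarith))

theorem eventually_pos_sub {x : ℝ} (hx : 0 < x) : ∀ᶠ ε in nhdsWithin (0 : ℝ) (Set.Ioi 0),
    0 < x - ε := by
  have h : ContinuousAt (fun ε : ℝ => x - ε) 0 := by fun_prop
  exact (h.eventually_const_lt (by simpa using hx)).filter_mono nhdsWithin_le_nhds

/-! ### Constraints and dimension bounds in terms of exponents -/

theorem le_mul_sub_of_exponents (hb : 2 ≤ b) (ha_pos : ∀ n, 0 < a n) (ha : StrictMono a)
    {η v V : ℝ} (hη : limsupRatio a = (η : EReal)) (hv : 0 < v) (hV : 0 ≤ V)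
    (hξ : Irrational ξ) (hu : ENNReal.ofReal v ≤ unifExponent b a ξ)
    (has : asympExponent b a ξ ≤ ENNReal.ofReal V) : v ≤ V * (η - v) := by
  have hη1 := one_le_of_limsupRatio_eq ha_pos ha hη
  have key : ∀ᶠ ε in nhdsWithin (0 : ℝ) (Set.Ioi 0),
      v - ε ≤ (V + ε) * ((η + ε) - (v - ε)) := by
    filter_upwards [eventually_pos_sub hv, self_mem_nhdsWithin] with ε hε (hε0 : 0 < ε)
    have hη0 : 0 < η + ε := by linarith
    obtain ⟨K, hK⟩ := exists_mem_boundedTypeSet hb ha_pos hη (by linarith : η < η + ε)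
      hη0 hε.le (by linarith : 0 ≤ V + ε) hξ
      (ofReal_sub_lt_of_le hv hε0 hu) (lt_ofReal_add_of_le hV hε0 has)
    have h := exponent_le_of_mem hb ha (div_pos hε hη0) (by linarith) hK
    rw [one_sub_div hη0.ne', ← mul_div_assoc] at h
    exact (div_le_div_iff_of_pos_right hη0).1 h
  have h1 : Tendsto (fun ε : ℝ => v - ε) (nhdsWithin 0 (Set.Ioi 0)) (nhds v) := by
    have : ContinuousAt (fun ε : ℝ => v - ε) 0 := by fun_prop
    simpa using this.tendsto.mono_left nhdsWithin_le_nhds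
  have h2 : Tendsto (fun ε : ℝ => (V + ε) * ((η + ε) - (v - ε))) (nhdsWithin 0 (Set.Ioi 0))
      (nhds (V * (η - v))) := by
    have : ContinuousAt (fun ε : ℝ => (V + ε) * ((η + ε) - (v - ε))) 0 := by fun_prop
    simpa using this.tendsto.mono_left nhdsWithin_le_nhds
  exact le_of_tendsto_of_tendsto h1 h2 key

theorem dimH_exponent_band_le (hb : 2 ≤ b) (ha_pos : ∀ n, 0 < a n) (ha : StrictMono a)
    {η v w V : ℝ} {s : ℝ≥0} (hη : limsupRatio a = (η : EReal)) (hv : 0 < v) (hw : 0 < w)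
    (hwV : w ≤ V) (hvw : v ≤ w * (η - v))
    (hs : (η * V - v - v * V) / (η * V - v) < s * (1 + w)) :
    dimH {ξ : ℝ | Irrational ξ ∧ ENNReal.ofReal v ≤ unifExponent b a ξ ∧
      ENNReal.ofReal w ≤ asympExponent b a ξ ∧ asympExponent b a ξ ≤ ENNReal.ofReal V} ≤ s := by
  have hV : 0 < V := hw.trans_le hwV
  have hηv : 0 < η - v := pos_of_mul_pos_right (hv.trans_le hvw) hw.le
  have hη0 : 0 < η := by linarith
  have hvV : v ≤ V * (η - v) := hvw.trans (by gcongr)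
  have hden : 0 < η * V - v := by nlinarith
  have hlt1 : (η * V - v - v * V) / (η * V - v) < 1 := by
    rw [div_lt_one hden]; nlinarith
  -- Strict room above the critical growth rate and below `s * (1 + w)` lets both conditions survive
  -- the `ε`-perturbation of the exponents.
  obtain ⟨γ, hγ, hγ'⟩ := exists_between (lt_min hlt1 hs)
  obtain ⟨hγ1, hγs⟩ := lt_min_iff.1 hγ'
  have hγ0 : 0 ≤ γ := (div_nonneg (by nlinarith) hden.le).trans hγ.le
  have hγc : (1 - γ) * (1 - v / η / V) < v / η := by
    rw [div_lt_iff₀ hden] at hγ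
    have h1 : (1 - γ) * (1 - v / η / V) = (1 - γ) * (η * V - v) / (η * V) := by field_simp
    have h2 : v / η = v * V / (η * V) := by field_simp
    rw [h1, h2]
    exact div_lt_div_of_pos_right (by nlinarith) (by positivity)
  have hcont : ContinuousAt (fun ε : ℝ => (v - ε) / (η + ε) -
      (1 - γ) * (1 - (v - ε) / (η + ε) / (V + ε))) 0 := by
    have h1 : ContinuousAt (fun ε : ℝ => (v - ε) / (η + ε)) 0 :=
      ContinuousAt.div (by fun_prop) (by fun_prop) (by simpa using hη0.ne')
    have h2 : ContinuousAt (fun ε : ℝ => (v - ε) / (η + ε) / (V + ε)) 0 :=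
      h1.div (by fun_prop) (by simpa using hV.ne')
    fun_prop
  have hcont' : ContinuousAt (fun ε : ℝ => s * (1 + (w - ε)) - γ) 0 := by fun_prop
  have hev1 := (hcont.eventually_const_lt (u := 0) (by simpa using hγc)).filter_mono
    (nhdsWithin_le_nhds (s := Set.Ioi 0))
  have hev2 := (hcont'.eventually_const_lt (u := 0) (by simpa using hγs)).filter_mono
    (nhdsWithin_le_nhds (s := Set.Ioi 0))
  obtain ⟨ε, h1, h2, h3, h4, (hε : 0 < ε)⟩ := (hev1.and (hev2.and ((eventually_pos_sub hv).and
    ((eventually_pos_sub hw).and self_mem_nhdsWithin)))).exists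
  have hsub : {ξ : ℝ | Irrational ξ ∧ ENNReal.ofReal v ≤ unifExponent b a ξ ∧
      ENNReal.ofReal w ≤ asympExponent b a ξ ∧ asympExponent b a ξ ≤ ENNReal.ofReal V} ⊆
      ⋃ K, {ξ | Irrational ξ ∧ ξ ∈ boundedTypeSet b a ((v - ε) / (η + ε)) (V + ε) K ∧
        ENNReal.ofReal w ≤ asympExponent b a ξ} := by
    rintro ξ ⟨hξ, hu, has, has'⟩
    obtain ⟨K, hK⟩ := exists_mem_boundedTypeSet hb ha_pos hη (by linarith : η < η + ε)
      (by linarith) h3.le (by linarith : 0 ≤ V + ε) hξ (ofReal_sub_lt_of_le hv hε hu)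
      (lt_ofReal_add_of_le hV.le hε has')
    exact Set.mem_iUnion.2 ⟨K, hξ, hK, has⟩
  refine (dimH_mono hsub).trans ?_
  rw [dimH_iUnion]
  refine iSup_le fun K => ?_
  obtain ⟨C, hC⟩ := exists_coversRecords_card_le (K := K) hb ha (by linarith : 0 < V + ε)
    hγ0 hγ1.le (sub_pos.1 h1)
  choose F hF hcard using hC
  refine dimH_le_of_frequently_near hb ha hγ0 h4.le (sub_pos.1 h2) F hcard ?_
  rintro ξ ⟨hξ, hK, has⟩
  refine (frequently_isRecordMin_and_lt hb ha hξ h4 ?_).mono fun N hN =>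
    ⟨hF N ξ hK hN.1, hN.2.le⟩
  exact (frequently_lt_of_lt_asympExponent hb (ofReal_sub_lt_of_le hw hε has)).mono
    fun N hN => ⟨N, le_rfl, hN⟩

theorem dimH_asympExponent_eq_top (hb : 2 ≤ b) (ha : StrictMono a) :
    dimH {ξ : ℝ | asympExponent b a ξ = ∞} = 0 := by
  have hb1 : (1 : ℝ) ≤ b := by exact_mod_cast (by omega : 1 ≤ b)
  have hsub : {ξ : ℝ | asympExponent b a ξ = ∞} ⊆
      ⋃ K : ℕ, {ξ : ℝ | |ξ| ≤ K ∧ asympExponent b a ξ = ∞} := fun ξ hξ => by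
    obtain ⟨K, hK⟩ := exists_nat_ge |ξ|
    exact Set.mem_iUnion.2 ⟨K, hK, hξ⟩
  have hle : ∀ s : ℝ≥0, 0 < s → dimH {ξ : ℝ | asympExponent b a ξ = ∞} ≤ s := by
    intro s hs
    have hs' : (0 : ℝ) < s := hs
    refine (dimH_mono hsub).trans ?_
    rw [dimH_iUnion]
    refine iSup_le fun K => ?_
    -- The trivial count `γ = 1` suffices: with `w = 1 / s`, `s * (1 + w) = s + 1 > 1`.
    refine dimH_le_of_frequently_near (γ := 1) (w := 1 / s) (C := 2 * K + 3) hb ha zero_le_one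
      (by positivity) ?_ (fun N => boundedIntegers K (b ^ a N)) (fun N => ?_) ?_
    · rw [mul_add, mul_one_div_cancel hs'.ne']
      linarith
    · rw [card_boundedIntegers, one_mul, Real.rpow_natCast]
      have := one_le_pow₀ hb1 (n := a N)
      push_cast
      nlinarith
    · rintro ξ ⟨hK, has⟩
      refine (frequently_lt_of_lt_asympExponent hb (w := 1 / s)
        (by rw [has]; exact ENNReal.ofReal_lt_top)).mono fun N hN => ⟨?_, hN.le⟩
      have := round_mem_boundedIntegers (m := b ^ a N) hK
      rwa [Nat.cast_pow] at this
  by_contra hne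
  obtain ⟨s, hs0, hs⟩ := ENNReal.lt_iff_exists_nnreal_btwn.1 (pos_iff_ne_zero.2 hne)
  exact absurd (hle s (by exact_mod_cast hs0)) (not_le.2 hs)

end

theorem theorem14 (b : ℕ) (hb : 2 ≤ b) (a : ℕ → ℕ) (ha_pos : ∀ n, 0 < a n) (ha : StrictMono a)
    (η : ℝ) (hη : limsupRatio a = (η : EReal)) :
    (∀ vhat θ : ℝ, 0 < vhat → vhat < η → 0 < θ →
      (θ < max 1 (1 / (η - vhat)) →
        unifSuperlevelSet b a (ENNReal.ofReal vhat) ∩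
          asympLevelSet b a (ENNReal.ofReal (θ * vhat)) = ∅) ∧
      (max 1 (1 / (η - vhat)) ≤ θ →
        dimH (unifSuperlevelSet b a (ENNReal.ofReal vhat) ∩
            asympLevelSet b a (ENNReal.ofReal (θ * vhat))) ≤
          ENNReal.ofReal
            ((η * θ - 1 - θ * vhat) / ((η * θ - 1) * (1 + θ * vhat)))) ∧
      (max 1 (1 / (η - vhat)) ≤ θ → ∀ ρ : ℝ, 0 ≤ ρ →
        dimH {ξ : ℝ | Irrational ξ ∧ ENNReal.ofReal vhat ≤ unifExponent b a ξ ∧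
            ENNReal.ofReal (θ * vhat) ≤ asympExponent b a ξ ∧
            asympExponent b a ξ ≤ ENNReal.ofReal (θ * vhat + ρ)} ≤
          ENNReal.ofReal
            ((vhat * (η * θ - 1 - θ * vhat) + ρ * (η - vhat)) /
              ((1 + θ * vhat) * ((η * θ - 1) * vhat + η * ρ))))) ∧
    dimH (unifSuperlevelSet b a (ENNReal.ofReal η)) = 0 := by
  refine ⟨fun v θ hv hvη hθ => ?_, ?_⟩
  · have hηv : 0 < η - v := sub_pos.2 hvη
    have hθv : 0 < θ * v := mul_pos hθ hv
    have band : max 1 (1 / (η - v)) ≤ θ → ∀ ρ : ℝ, 0 ≤ ρ →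
        dimH {ξ : ℝ | Irrational ξ ∧ ENNReal.ofReal v ≤ unifExponent b a ξ ∧
            ENNReal.ofReal (θ * v) ≤ asympExponent b a ξ ∧
            asympExponent b a ξ ≤ ENNReal.ofReal (θ * v + ρ)} ≤
          ENNReal.ofReal ((v * (η * θ - 1 - θ * v) + ρ * (η - v)) /
              ((1 + θ * v) * ((η * θ - 1) * v + η * ρ))) := by
      intro hmax ρ hρ
      have h1 : 1 ≤ θ * (η - v) := (div_le_iff₀ hηv).1 ((le_max_right _ _).trans hmax)
      refine le_of_not_gt fun hlt => ?_
      obtain ⟨s, hs1, hs2⟩ := ENNReal.lt_iff_exists_nnreal_btwn.1 hlt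
      refine absurd (dimH_exponent_band_le (s := s) hb ha_pos ha hη hv hθv
        (by linarith : θ * v ≤ θ * v + ρ) (by nlinarith) ?_) (not_le.2 hs2)
      have h2 := coe_lt_of_ofReal_lt_coe hs1
      -- The remaining quotient is the critical growth rate at `V = θ * v + ρ`.
      rw [mul_comm (1 + θ * v), ← div_div, div_lt_iff₀ (by linarith)] at h2
      refine lt_of_eq_of_lt ?_ h2
      congr 1 <;> ring
    refine ⟨fun hlt => ?_, fun hmax => ?_, band⟩
    · rw [Set.eq_empty_iff_forall_notMem]
      rintro ξ ⟨⟨hξ, hu⟩, -, has⟩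
      rcases lt_max_iff.1 hlt with h | h
      · have h1 := hu.trans (unifExponent_le_asympExponent hb ha hξ)
        rw [has, ENNReal.ofReal_le_ofReal_iff hθv.le] at h1
        nlinarith
      · have h1 := le_mul_sub_of_exponents hb ha_pos ha hη hv hθv.le hξ hu has.le
        rw [lt_div_iff₀ hηv] at h
        nlinarith
    · have h := band hmax 0 le_rfl
      have heq : (v * (η * θ - 1 - θ * v) + 0 * (η - v)) /
          ((1 + θ * v) * ((η * θ - 1) * v + η * 0)) =
          (η * θ - 1 - θ * v) / ((η * θ - 1) * (1 + θ * v)) := by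
        rw [zero_mul, mul_zero, add_zero, add_zero,
          show (1 + θ * v) * ((η * θ - 1) * v) = v * ((η * θ - 1) * (1 + θ * v)) by ring,
          mul_div_mul_left _ _ hv.ne']
      rw [heq] at h
      refine (dimH_mono ?_).trans h
      rintro ξ ⟨⟨hξ, hu⟩, -, has⟩
      exact ⟨hξ, hu, has.ge, by rw [add_zero]; exact has.le⟩
  · have hη1 := one_le_of_limsupRatio_eq ha_pos ha hη
    refine le_antisymm ((dimH_mono ?_).trans (dimH_asympExponent_eq_top hb ha).le) zero_le
    rintro ξ ⟨hξ, hu⟩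
    -- A finite asymptotic exponent `V` would give `η ≤ V * (η - η) = 0`.
    by_contra hne
    have h := le_mul_sub_of_exponents hb ha_pos ha hη (by linarith) ENNReal.toReal_nonneg hξ hu
      (ENNReal.ofReal_toReal hne).ge
    rw [sub_self, mul_zero] at h
    linarith
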